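/- Let $p$ be an odd prime. Let $G$ be a finite $p$-group in which every element commutes with its image under every endomorphism of $G$ (a finite $pE$-group), and suppose that $G$ is $3$-generator, that is, generated by at most three elements. If the exponent of $G$ satisfies $\exp(G)\le p^2$, then $G$ is abelian. -/

import Mathlib

/-- An E-group: every element commutes with each of its endomorphic images. -/
def IsEGroup (G : Type*) [Group G] : Prop :=
  ∀ (f : G →* G) (g : G), Commute g (f g)

/-- A pE-group: an E-group that is also a p-group. -/
def IsPEGroup (p : ℕ) (G : Type*) [Group G] : Prop :=
  IsPGroup p G ∧ IsEGroup G

/-- An n-generator group: it is generated by some set of at most n elements. -/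
def IsNGenerator (n : ℕ) (G : Type*) [Group G] : Prop :=
  ∃ S : Finset G, S.card ≤ n ∧ Subgroup.closure (S : Set G) = ⊤

/-! Suppose `G` is not abelian. The quotient `G/G'` maps onto a cyclic group of order `exp(G/G')`,
and sending a generator to any `u` of order dividing that number gives an endomorphism of `G`. The
E-condition applied to it makes `u` central. Hence `exp(G/G') = p`, since `p^2` would make all of
`G` central, and every element of order `p` is central. As `⁅x, y⁆ ^ p = ⁅x ^ p, y⁆`, the subgroup
`G'` is central and elementary abelian.

So `G` is encoded by `𝔽ₚ`-spaces `V = G/G'` with `dim V ≤ 3` and `W = G'`, the commutator form `κ`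
and the `p`-th power map `π : V → W`, which is linear because `p` is odd. Pairs `(φ, ψ)` compatible
with `κ` and `π` lift to endomorphisms of `G` (`exists_endomorphism_lift`), so it remains to find
one with `κ v (φ v) ≠ 0` (`alternating_eq_zero_of_endomorphisms`).

In three dimensions `κ` is the cross product followed by a linear map `c`. If `π` has a kernel,
dimension counting forces `κ = 0`. Otherwise `π` and `c` identify `V` and `W` with `F³`, and `π`
becomes an invertible matrix `M`. Compatible pairs then include the isometries of the bilinear form
`M` of determinant one, and a non-scalar one always exists. -/

open scoped commutatorElement

/-! ### Isometries of bilinear forms in dimension three -/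

open Matrix in
/-- A `3 × 3` matrix mapping every vector to a parallel one is scalar. -/
theorem Matrix.eq_smul_one_of_cross_mulVec_eq_zero {F : Type*} [Field F]
    (A : Matrix (Fin 3) (Fin 3) F) (h : ∀ v, v ⨯₃ (A *ᵥ v) = 0) : ∃ c : F, A = c • 1 := by
  refine ⟨A 0 0, ?_⟩
  have key := fun x y z => h ![x, y, z]
  simp only [cross_apply, Matrix.mulVec, dotProduct, Fin.sum_univ_three] at key
  -- Basis vectors kill the off-diagonal entries; the two sums equate the diagonal ones.
  have h0 := key 1 0 0
  have h1 := key 0 1 0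
  have h2 := key 0 0 1
  have h3 := key 1 1 0
  have h4 := key 1 0 1
  simp at h0 h1 h2 h3 h4
  ext i j
  fin_cases i <;> fin_cases j <;> simp <;> grind

open Matrix in
/-- A nonzero symmetric matrix in odd characteristic has a non-isotropic vector. -/
theorem Matrix.IsSymm.exists_dotProduct_mulVec_ne_zero {F n : Type*} [Field F] [Fintype n]
    [DecidableEq n] (h2 : (2 : F) ≠ 0) {M : Matrix n n F} (hs : M.IsSymm) (hM : M ≠ 0) :
    ∃ v, v ⬝ᵥ (M *ᵥ v) ≠ 0 := by
  by_contra! h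
  apply hM
  ext i j
  have hi := h (Pi.single i 1)
  have hj := h (Pi.single j 1)
  have hij := h (Pi.single i 1 + Pi.single j 1)
  have hsym : M j i = M i j := hs.apply i j
  simp only [Matrix.mulVec_add, add_dotProduct, dotProduct_add, Matrix.mulVec_single_one,
    single_one_dotProduct, Matrix.col_apply] at hi hj hij
  have : 2 * M i j = 0 := by linear_combination hij - hi - hj - hsym
  simpa [h2] using this

open Matrix in
/-- A nondegenerate bilinear form in dimension three and odd characteristic has a non-scalar
isometry. -/
theorem Matrix.exists_isometry_ne_smul_one {F : Type*} [Field F] (h2 : (2 : F) ≠ 0)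
    (M : Matrix (Fin 3) (Fin 3) F) (hM : IsUnit M.det) :
    ∃ A : Matrix (Fin 3) (Fin 3) F, Aᵀ * M * A = M ∧ ∀ c : F, A ≠ c • 1 := by
  have hM0 : M ≠ 0 := by
    rintro rfl
    simp at hM
  by_cases hs : Mᵀ = M
  · obtain ⟨v, hv⟩ := Matrix.IsSymm.exists_dotProduct_mulVec_ne_zero h2 hs hM0
    set β := v ⬝ᵥ (M *ᵥ v) with hβ
    -- `P` is the orthogonal projection onto the line of `v`, so `2 * P - 1` is the negative of the
    -- reflection in `v`.
    set P : Matrix (Fin 3) (Fin 3) F := β⁻¹ • vecMulVec v (M *ᵥ v) with hP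
    have hPP : P * P = P := by
      rw [hP, smul_mul_smul_comm, vecMulVec_mul_vecMulVec, dotProduct_comm, ← hβ, vecMulVec_smul,
        smul_smul, inv_mul_cancel_right₀ hv]
    have hPM : Pᵀ * M = M * P := by
      rw [hP, transpose_smul, transpose_vecMulVec, smul_mul_assoc, mul_smul_comm,
        mul_vecMulVec, vecMulVec_mul, ← mulVec_transpose, hs]
    refine ⟨2 * P - 1, ?_, fun c hc => ?_⟩
    · have : (2 * P - 1)ᵀ * M = M * (2 * P - 1) := by
        simp only [two_mul, transpose_sub, transpose_add, transpose_one, sub_mul, add_mul, hPM,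
          mul_sub, mul_add, one_mul, mul_one]
      rw [this, mul_assoc]
      have : (2 * P - 1) * (2 * P - 1) = 1 := by
        have : (2 * P - 1) * (2 * P - 1) = 4 * (P * P) - 4 * P + 1 := by noncomm_ring
        rw [this, hPP, sub_self, zero_add]
      rw [this, mul_one]
    · have hPc : P = ((c + 1) / 2) • (1 : Matrix (Fin 3) (Fin 3) F) := by
        ext i j
        have := congrFun (congrFun hc i) j
        simp only [two_mul, sub_apply, add_apply, smul_apply, smul_eq_mul] at this ⊢
        field_simp
        linear_combination this
      have hdet : P.det = 0 := by
        rw [hP, det_smul, det_vecMulVec, mul_zero]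
      have hc0 : (c + 1) / 2 = 0 := by
        rw [hPc, det_smul] at hdet
        simpa using hdet
      have hPv : P *ᵥ v = v := by
        rw [hP, smul_mulVec, vecMulVec_mulVec, dotProduct_comm, ← hβ]
        ext i
        simp
        field_simp
      rw [hPc, hc0, zero_smul, zero_mulVec] at hPv
      exact hv (by rw [hβ, ← hPv]; simp)
  · have hMt : IsUnit Mᵀ.det := by rwa [det_transpose]
    -- The asymmetry of a form is always an isometry. If it is a scalar `c`, determinants give `c ^
    -- 3 = 1` and transposing twice gives `c ^ 2 = 1`, so `c = 1` and `M` is symmetric.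
    refine ⟨M⁻¹ * Mᵀ, ?_, fun c hc => hs ?_⟩
    · rw [transpose_mul, transpose_transpose, transpose_nonsing_inv, mul_assoc M,
        mul_assoc M, mul_assoc, mul_nonsing_inv_cancel_left _ _ hM]
      rw [nonsing_inv_mul _ hMt, mul_one]
    · have hMc : Mᵀ = c • M := by
        have := congrArg (M * ·) hc
        simpa [mul_nonsing_inv_cancel_left _ _ hM] using this
      have hdet : M.det = c ^ 3 * M.det := by
        have := congrArg det hMc
        simpa [det_transpose, det_smul] using this
      have hc3 : c ^ 3 = 1 := by
        have := hM.ne_zero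
        apply mul_right_cancel₀ this
        rw [← hdet, one_mul]
      have hM2 : M = (c * c) • M := by
        rw [← smul_smul, ← hMc, ← transpose_smul, ← hMc, transpose_transpose]
      have hc2 : c * c = 1 := by
        by_contra hne
        apply hM0
        have : (1 - c * c) • M = 0 := by rw [sub_smul, one_smul, ← hM2, sub_self]
        exact (smul_eq_zero.mp this).resolve_left (sub_ne_zero.mpr (Ne.symm hne))
      have : c = 1 := by linear_combination hc3 - c * hc2
      rw [hMc, this, one_smul]

open Matrix in
/-- The same with determinant one, and with non-scalarity expressed by the cross product. -/
theorem Matrix.exists_isometry_det_eq_one {F : Type*} [Field F] (h2 : (2 : F) ≠ 0)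
    (M : Matrix (Fin 3) (Fin 3) F) (hM : IsUnit M.det) :
    ∃ A : Matrix (Fin 3) (Fin 3) F, Aᵀ * M * A = M ∧ A.det = 1 ∧ ∃ v, v ⨯₃ (A *ᵥ v) ≠ 0 := by
  obtain ⟨A, hA, hc⟩ := Matrix.exists_isometry_ne_smul_one h2 M hM
  have hv : ∃ v, v ⨯₃ (A *ᵥ v) ≠ 0 := by
    by_contra! h
    obtain ⟨c, h⟩ := Matrix.eq_smul_one_of_cross_mulVec_eq_zero A h
    exact hc c h
  have hd : A.det ^ 2 = 1 := by
    have := congrArg det hA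
    rw [det_mul, det_mul, det_transpose] at this
    apply mul_right_cancel₀ hM.ne_zero
    linear_combination this
  rcases eq_or_eq_neg_of_sq_eq_sq A.det 1 (by rw [hd, one_pow]) with h | h
  · exact ⟨A, hA, h, hv⟩
  -- The dimension is odd, so negation flips the sign of the determinant.
  · refine ⟨-A, by simpa using hA, ?_, ?_⟩
    · simp [det_neg, h, Fintype.card_fin, pow_succ]
    · obtain ⟨v, hv⟩ := hv
      exact ⟨v, by rwa [neg_mulVec, map_neg, neg_ne_zero]⟩

/-! ### Cross products and alternating maps -/

-- Pairing both sides with `u` gives the multiplicativity of the triple product. For determinant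
-- one, `A` thus acts on cross products as its inverse transpose.
open Matrix in
theorem Matrix.transpose_mulVec_cross_mulVec {F : Type*} [CommRing F]
    (A : Matrix (Fin 3) (Fin 3) F) (v w : Fin 3 → F) :
    Aᵀ *ᵥ ((A *ᵥ v) ⨯₃ (A *ᵥ w)) = A.det • (v ⨯₃ w) := by
  ext i
  fin_cases i <;>
  simp [cross_apply, Matrix.mulVec, dotProduct, Fin.sum_univ_three, det_fin_three] <;> ring

open Matrix in
theorem finrank_ker_crossProduct_le_one {F : Type*} [Field F] {n : Fin 3 → F} (hn : n ≠ 0) :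
    Module.finrank F (LinearMap.ker (crossProduct n)) ≤ 1 := by
  have hle : LinearMap.ker (crossProduct n) ≤ Submodule.span F {n} := by
    intro x hx
    have hdep : ¬ LinearIndependent F ![n, x] := fun h =>
      crossProduct_ne_zero_iff_linearIndependent.mpr h hx
    rw [LinearIndependent.pair_iff' hn] at hdep
    push Not at hdep
    exact Submodule.mem_span_singleton.mpr hdep
  exact (Submodule.finrank_mono hle).trans (finrank_span_singleton hn).le

theorem LinearMap.map_smul_sum_single {F ι V : Type*} [CommRing F] [Fintype ι] [DecidableEq ι]
    [AddCommGroup V] [Module F V] (s : (ι → F) →ₗ[F] V) (x : ι → F) :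
    ∑ i, x i • s (Pi.single i 1) = s x := by
  conv_rhs => rw [← Finset.univ_sum_single x, map_sum]
  refine Finset.sum_congr rfl fun i _ => ?_
  rw [← map_smul, ← Pi.single_smul, smul_eq_mul, mul_one]

open Matrix in
/-- An alternating bilinear map on a quotient of `F³` factors through the cross product. -/
theorem exists_linearMap_crossProduct {F V W : Type*} [Field F] [AddCommGroup V] [Module F V]
    [AddCommGroup W] [Module F W] (κ : V →ₗ[F] V →ₗ[F] W) (halt : ∀ v, κ v v = 0)
    (s : (Fin 3 → F) →ₗ[F] V) :
    ∃ c : (Fin 3 → F) →ₗ[F] W, ∀ x y, κ (s x) (s y) = c (x ⨯₃ y) := by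
  have hskew : ∀ v w, κ w v = - κ v w := fun v w => (LinearMap.IsAlt.neg halt v w).symm
  set e : Fin 3 → V := fun i => s (Pi.single i 1) with he
  have hs : ∀ x, s x = x 0 • e 0 + x 1 • e 1 + x 2 • e 2 := fun x => by
    rw [← LinearMap.map_smul_sum_single s x, Fin.sum_univ_three]
  refine ⟨Fintype.linearCombination F ![κ (e 1) (e 2), κ (e 2) (e 0), κ (e 0) (e 1)],
    fun x y => ?_⟩
  rw [hs x, hs y]
  simp only [map_add, map_smul, LinearMap.add_apply, LinearMap.smul_apply, halt,
    hskew (e 0) (e 1), hskew (e 1) (e 2), hskew (e 2) (e 0), cross_apply,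
    Fintype.linearCombination_apply, Fin.sum_univ_three, cons_val]
  module

open Matrix in
/-- An alternating map `κ : V × V → W` with a linear map `π : V → W` with kernel in the radical
of `κ`, where `dim V ≤ 3` and the values of `κ` span `W`, vanishes if all compatible
endomorphisms map each vector to one orthogonal to it. -/
theorem alternating_eq_zero_of_endomorphisms {F V W : Type*} [Field F] (h2 : (2 : F) ≠ 0)
    [AddCommGroup V] [Module F V] [AddCommGroup W] [Module F W]
    (κ : V →ₗ[F] V →ₗ[F] W) (halt : ∀ v, κ v v = 0)
    (hspan : Submodule.span F {x | ∃ v w, κ v w = x} = ⊤)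
    (π : V →ₗ[F] W) (hπ : ∀ v, π v = 0 → κ v = 0)
    (s : (Fin 3 → F) →ₗ[F] V) (hs : Function.Surjective s)
    (hE : ∀ (φ : V →ₗ[F] V) (ψ : W →ₗ[F] W), (∀ v, ψ (π v) = π (φ v)) →
      (∀ v w, ψ (κ v w) = κ (φ v) (φ w)) → ∀ v, κ v (φ v) = 0) : κ = 0 := by
  obtain ⟨c, hc⟩ := exists_linearMap_crossProduct κ halt s
  suffices c = 0 by
    ext v w
    obtain ⟨x, rfl⟩ := hs v
    obtain ⟨y, rfl⟩ := hs w
    simp [hc, this]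
  have hcr : LinearMap.range c = ⊤ := by
    rw [eq_top_iff, ← hspan, Submodule.span_le]
    rintro _ ⟨v, w, rfl⟩
    obtain ⟨x, rfl⟩ := hs v
    obtain ⟨y, rfl⟩ := hs w
    exact ⟨_, (hc x y).symm⟩
  have hcs : Function.Surjective c := LinearMap.range_eq_top.mp hcr
  have : FiniteDimensional F W := Module.Finite.of_surjective c hcs
  have hcdim := c.finrank_range_add_finrank_ker
  rw [hcr, finrank_top, Module.finrank_fin_fun] at hcdim
  have hkdim := (π ∘ₗ s).finrank_range_add_finrank_ker
  rw [Module.finrank_fin_fun] at hkdim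
  have hrle : Module.finrank F (LinearMap.range (π ∘ₗ s)) ≤ Module.finrank F W :=
    Submodule.finrank_le _
  have hker : ∀ x, (π ∘ₗ s) x = 0 → ∀ y, c (x ⨯₃ y) = 0 := fun x hx y => by
    rw [← hc, hπ _ hx, LinearMap.zero_apply]
  by_cases hK : LinearMap.ker (π ∘ₗ s) = ⊥
  · exfalso
    have hinj : Function.Injective (π ∘ₗ s) := LinearMap.ker_eq_bot.mp hK
    rw [hK, finrank_bot] at hkdim
    have hcinj : Function.Injective c := by
      rw [← LinearMap.ker_eq_bot, ← Submodule.finrank_eq_zero]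
      omega
    let C := LinearEquiv.ofBijective c ⟨hcinj, hcs⟩
    let S := LinearEquiv.ofBijective s ⟨Function.Injective.of_comp (f := π) hinj, hs⟩
    have hC : ∀ x, C x = c x := fun _ => rfl
    have hS : ∀ x, S x = s x := fun _ => rfl
    let f : (Fin 3 → F) →ₗ[F] (Fin 3 → F) := C.symm.toLinearMap ∘ₗ π ∘ₗ s
    let M := LinearMap.toMatrix' f
    have hMf : ∀ x, C (M *ᵥ x) = π (s x) := fun x => by
      simp [M, f, LinearMap.toMatrix'_mulVec]
    have hM : IsUnit M.det := by
      rw [← Matrix.isUnit_iff_isUnit_det, ← Matrix.mulVec_injective_iff_isUnit]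
      intro x y hxy
      apply hinj
      simpa [hMf] using congrArg C hxy
    obtain ⟨A, hA, hdet, v, hv⟩ := Matrix.exists_isometry_det_eq_one h2 M hM
    -- The isometry equation says that `M * A * M⁻¹` is the inverse transpose of `A`. The same
    -- matrix therefore intertwines both `π` and `κ`.
    have hcross : ∀ x y, (M * A * M⁻¹) *ᵥ (x ⨯₃ y) = (A *ᵥ x) ⨯₃ (A *ᵥ y) := fun x y => by
      have hAt : Function.Injective (Aᵀ *ᵥ ·) := by
        rw [Matrix.mulVec_injective_iff_isUnit, Matrix.isUnit_iff_isUnit_det, det_transpose, hdet]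
        exact isUnit_one
      apply hAt
      simp only [Matrix.transpose_mulVec_cross_mulVec, hdet, one_smul, mulVec_mulVec,
        ← mul_assoc, hA, mul_nonsing_inv _ hM, one_mulVec]
    refine hv (hcinj ?_)
    rw [map_zero, ← hc]
    have := hE (S.toLinearMap ∘ₗ A.mulVecLin ∘ₗ S.symm.toLinearMap)
      (C.toLinearMap ∘ₗ (M * A * M⁻¹).mulVecLin ∘ₗ C.symm.toLinearMap) ?_ ?_ (s v)
    · simpa [← hS] using this
    · intro u
      obtain ⟨x, rfl⟩ := hs u
      rw [← hMf]
      simp only [LinearMap.comp_apply, LinearEquiv.coe_coe, LinearEquiv.symm_apply_apply, ← hS]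
      simp only [hS, mulVecLin_apply, ← hMf, mulVec_mulVec,
        nonsing_inv_mul_cancel_right _ _ hM]
    · intro u w
      obtain ⟨x, rfl⟩ := hs u
      obtain ⟨y, rfl⟩ := hs w
      rw [hc, ← hC]
      simp only [LinearMap.comp_apply, LinearEquiv.coe_coe, LinearEquiv.symm_apply_apply, ← hS]
      simp only [hS, mulVecLin_apply, hcross, hc, hC]
  · obtain ⟨x, hx, hx0⟩ := Submodule.exists_mem_ne_zero_of_ne_bot hK
    have hdim : Module.finrank F W ≤ 1 := by
      have h1 := (crossProduct x).finrank_range_add_finrank_ker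
      rw [Module.finrank_fin_fun] at h1
      -- A vector `x` in the kernel puts the plane of all `x ⨯₃ y` inside `ker c`.
      have h3 : LinearMap.range (crossProduct x) ≤ LinearMap.ker c := by
        rintro _ ⟨y, rfl⟩
        exact hker x hx y
      have := Submodule.finrank_mono h3
      have := finrank_ker_crossProduct_le_one hx0
      omega
    by_contra hc0
    obtain ⟨z, hz⟩ : ∃ z, c z ≠ 0 := by
      by_contra! h
      exact hc0 (LinearMap.ext h)
    obtain ⟨l, hl⟩ : ∃ l : Module.Dual F W, l (c z) ≠ 0 := by
      by_contra! h
      exact hz ((Module.forall_dual_apply_eq_zero_iff F _).mp h)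
    let n : Fin 3 → F := fun i => l (c (Pi.single i 1))
    have hn : ∀ y, l (c y) = n ⬝ᵥ y := fun y => by
      rw [dotProduct_comm]
      exact (LinearMap.map_smul_sum_single (l ∘ₗ c) y).symm
    have hn0 : n ≠ 0 := by
      intro h
      rw [hn, h, zero_dotProduct] at hl
      exact hl rfl
    -- By the triple product, kernel vectors are parallel to `n`; yet `dim W ≤ 1` leaves a kernel of
    -- dimension at least two.
    have hle : LinearMap.ker (π ∘ₗ s) ≤ LinearMap.ker (crossProduct n) := by
      intro k hk
      rw [LinearMap.mem_ker]
      refine dotProduct_eq_zero _ fun y => ?_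
      rw [dotProduct_comm, triple_product_permutation, ← hn, hker k hk, map_zero]
    have := Submodule.finrank_mono hle
    have := finrank_ker_crossProduct_le_one hn0
    omega

/-! ### Central elements from cyclic quotients -/

/-- A finite commutative group maps onto a cyclic group of order its exponent. -/
theorem CommGroup.exists_surjective_cyclic (A : Type*) [CommGroup A] [Finite A] :
    ∃ f : A →* Multiplicative (ZMod (Monoid.exponent A)), Function.Surjective f := by
  have : NeZero (Monoid.exponent A) := ⟨Monoid.exponent_ne_zero_of_finite⟩
  obtain ⟨e⟩ := CommGroup.monoidHom_mulEquiv_of_hasEnoughRootsOfUnity A ℂ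
  have : Finite (A →* ℂˣ) := Finite.of_equiv _ e.symm.toEquiv
  -- The character group is isomorphic to `A`, so some character has order the exponent; its image
  -- is the cyclic quotient.
  obtain ⟨χ, hχ⟩ := Monoid.exists_orderOf_eq_exponent
    (Monoid.ExponentExists.of_finite (G := A →* ℂˣ))
  rw [Monoid.exponent_eq_of_mulEquiv e] at hχ
  have : Finite χ.range := Set.finite_range χ
  have hcyc : IsCyclic χ.range := isCyclic_subgroup_units _
  have hcard : Nat.card χ.range = Monoid.exponent A := by
    rw [← hcyc.exponent_eq_card]
    apply Nat.dvd_antisymm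
    · rw [Monoid.exponent_dvd_iff_forall_pow_eq_one]
      rintro ⟨_, a, rfl⟩
      ext1
      simp [← map_pow, Monoid.pow_exponent_eq_one]
    · rw [← hχ]
      apply orderOf_dvd_of_pow_eq_one
      ext1 a
      have := Monoid.pow_exponent_eq_one (⟨χ a, a, rfl⟩ : χ.range)
      simpa using congrArg Subtype.val this
  have e' := (zmodCyclicMulEquiv hcyc).symm
  rw [hcard] at e'
  exact ⟨e'.toMonoidHom.comp χ.rangeRestrict,
    e'.surjective.comp χ.rangeRestrict_surjective⟩

/-- In a finite E-group, elements of order dividing the exponent of the abelianization are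
central. -/
theorem IsEGroup.mem_center_of_pow_exponent_abelianization {G : Type*} [Group G] [Finite G]
    (hE : IsEGroup G) {u : G} (hu : u ^ Monoid.exponent (Abelianization G) = 1) :
    u ∈ Subgroup.center G := by
  obtain ⟨χ, hχ⟩ := CommGroup.exists_surjective_cyclic (Abelianization G)
  generalize Monoid.exponent (Abelianization G) = n at χ hu
  let θ : Multiplicative (ZMod n) →* G :=
    AddMonoidHom.toMultiplicativeLeft (ZMod.lift n ⟨zmultiplesHom (Additive G) (Additive.ofMul u), by
      simpa [← ofMul_pow] using hu⟩)
  have hθ : ∀ k : ℤ, θ (Multiplicative.ofAdd (k : ZMod n)) = u ^ k := fun k => by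
    simp [θ]
  let f := (θ.comp χ).comp Abelianization.of
  obtain ⟨a, ha⟩ := hχ (Multiplicative.ofAdd 1)
  obtain ⟨g₀, rfl⟩ := QuotientGroup.mk_surjective a
  have h0 : f g₀ = u := by
    have := hθ 1
    rw [Int.cast_one, zpow_one, ← ha] at this
    exact this
  have hg₀ : Commute g₀ u := h0 ▸ hE f g₀
  rw [Subgroup.mem_center_iff]
  intro g
  obtain ⟨k, hk⟩ := ZMod.intCast_surjective (Multiplicative.toAdd (χ (Abelianization.of g)))
  have hg : f g = u ^ k := by
    rw [← hθ, hk]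
    rfl
  -- The exponent is chosen so that `f` sends this element to `u`; since `g₀` commutes with `u`, so
  -- does `g`.
  have h1 := hE f (g * g₀ ^ (1 - k))
  rw [map_mul, map_zpow, hg, h0, ← zpow_add, add_sub_cancel, zpow_one] at h1
  have := h1.mul_left (hg₀.zpow_left (1 - k)).inv_left
  rwa [mul_inv_cancel_right] at this

/-! ### Commutators and powers -/

/-- E-groups are 2-Engel, so commutators are homogeneous in each variable. -/
theorem IsEGroup.commutatorElement_pow_left {G : Type*} [Group G] (hE : IsEGroup G) (x y : G)
    (n : ℕ) : ⁅x ^ n, y⁆ = ⁅x, y⁆ ^ n := by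
  have h : Commute x (y * x * y⁻¹) := by simpa using hE (MulAut.conj y).toMonoidHom x
  have h2 : ⁅x, y⁆ = x * (y * x * y⁻¹)⁻¹ := by simp [commutatorElement_def, mul_assoc]
  rw [h2, h.inv_right.mul_pow, inv_pow, conj_pow]
  simp [commutatorElement_def, mul_assoc]

/-- The power of a product when the commutators are central. -/
theorem mul_pow_mul_commutatorElement_pow {G : Type*} [Group G] (x y : G)
    (hc : ⁅y, x⁆ ∈ Subgroup.center G) (n : ℕ) :
    (x * y) ^ n = x ^ n * y ^ n * ⁅y, x⁆ ^ (n * (n - 1) / 2) := by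
  have hc₁ : ∀ g, Commute g ⁅y, x⁆ := Subgroup.mem_center_iff.mp hc
  have hcz : ∀ k g, Commute g (⁅y, x⁆ ^ k) := fun k g => (hc₁ g).pow_right k
  have hyx : ∀ n : ℕ, y ^ n * x = x * y ^ n * ⁅y, x⁆ ^ n := fun n => by
    have hyx1 : y * x = x * y * ⁅y, x⁆ := by
      rw [(hc₁ _).eq]
      simp [commutatorElement_def, mul_assoc]
    induction n with
    | zero => simp
    | succ n ih =>
      rw [pow_succ y, mul_assoc, hyx1, ← mul_assoc, ← mul_assoc, ih, mul_assoc (x * y ^ n),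
        ← (hcz n y).eq, pow_succ ⁅y, x⁆]
      simp only [mul_assoc]
  induction n with
  | zero => simp
  | succ n ih =>
    rw [pow_succ (x * y), ih, Nat.triangle_succ, Nat.add_comm (_ / 2), pow_add ⁅y, x⁆ n, mul_assoc (x ^ n * y ^ n),
      ← (hcz _ (x * y)).eq, ← mul_assoc, ← mul_assoc, mul_assoc (x ^ n), hyx, pow_succ x,
      pow_succ y]
    simp only [mul_assoc]
    rw [← mul_assoc _ y, ← (hcz n y).eq]
    simp only [mul_assoc]

/-! ### Splitting and lifting of endomorphisms -/

/-- A surjection between elementary abelian groups splits. -/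
theorem AddMonoidHom.exists_rightInverse_of_zmod {p : ℕ} [Fact p.Prime] {Q V : Type*}
    [AddCommGroup Q] [AddCommGroup V] [Module (ZMod p) V] (hQ : ∀ x : Q, p • x = 0)
    (t : Q →+ V) (ht : Function.Surjective t) : ∃ σ : V →+ Q, ∀ v, t (σ v) = v := by
  let : Module (ZMod p) Q := AddCommGroup.zmodModule hQ
  obtain ⟨σ, hσ⟩ := (AddMonoidHom.toZModLinearMap p t).exists_rightInverse_of_surjective
    (LinearMap.range_eq_top.mpr ht)
  exact ⟨σ.toAddMonoidHom, LinearMap.congr_fun hσ⟩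

/-- A homomorphism onto an `𝔽ₚ`-space splits modulo a subgroup of its kernel with elementary
abelian quotient. -/
theorem exists_subgroup_inf_ker_eq {p : ℕ} [Fact p.Prime] {H V : Type*} [Group H]
    [AddCommGroup V] [Module (ZMod p) V] (T : H →* Multiplicative V)
    (hT : Function.Surjective T) (D : Subgroup H) (hcomm : ∀ x y : H, ⁅x, y⁆ ∈ D)
    (hpow : ∀ x : H, x ^ p ∈ D) (hD : D ≤ T.ker) :
    ∃ L : Subgroup H, (∀ x ∈ L, T x = 1 → x ∈ D) ∧ D ≤ L ∧ ∀ v, ∃ x ∈ L, T x = v := by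
  have : D.Normal := by
    refine ⟨fun x hx g => ?_⟩
    have := mul_mem (hcomm g x) hx
    rwa [commutatorElement_def, inv_mul_cancel_right] at this
  obtain ⟨Q, _, r, T', hr, hrD, hT'⟩ : ∃ (Q : Type _) (_ : CommGroup Q) (r : H →* Q)
      (T' : Q →* Multiplicative V), Function.Surjective r ∧ (∀ x, r x = 1 ↔ x ∈ D) ∧
        ∀ x, T' (r x) = T x := by
    refine ⟨H ⧸ D, { (inferInstance : Group (H ⧸ D)) with mul_comm := ?_ }, QuotientGroup.mk' D,
      QuotientGroup.lift D T hD, QuotientGroup.mk_surjective, QuotientGroup.eq_one_iff,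
      fun _ => rfl⟩
    intro a b
    induction a using QuotientGroup.induction_on with | _ a
    induction b using QuotientGroup.induction_on with | _ b
    rw [← commutatorElement_eq_one_iff_mul_comm]
    exact (QuotientGroup.eq_one_iff ⁅a, b⁆).mpr (hcomm a b)
  have hQ : ∀ x : Additive Q, p • x = 0 := fun x => by
    obtain ⟨y, hy⟩ := hr x.toMul
    have := (hrD (y ^ p)).mpr (hpow y)
    rw [map_pow, hy] at this
    exact this
  have hts : Function.Surjective (MonoidHom.toAdditiveLeft T') := fun v => by
    obtain ⟨x, hx⟩ := hT (Multiplicative.ofAdd v)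
    rw [← hT'] at hx
    exact ⟨Additive.ofMul (r x), congrArg Multiplicative.toAdd hx⟩
  obtain ⟨σ, hσ⟩ := AddMonoidHom.exists_rightInverse_of_zmod hQ _ hts
  have hσ : ∀ v, T' (AddMonoidHom.toMultiplicativeLeft σ v) = v := fun v =>
    congrArg Multiplicative.ofAdd (hσ v.toAdd)
  refine ⟨(AddMonoidHom.toMultiplicativeLeft σ).range.comap r, ?_, ?_, ?_⟩
  · rintro x ⟨v, hv⟩ hx
    have h1 := hσ v
    rw [hv, hT', hx] at h1
    rw [← hrD, ← hv, ← h1, map_one]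
  · intro x hx
    rw [Subgroup.mem_comap, (hrD x).mpr hx]
    exact one_mem _
  · intro v
    obtain ⟨x, hx⟩ := hr (AddMonoidHom.toMultiplicativeLeft σ v)
    exact ⟨x, ⟨v, hx.symm⟩, by rw [← hT', hx, hσ]⟩

open Multiplicative in
/-- Lifting an endomorphism of `G / G'` to `G`, for `G` a central extension of an `𝔽ₚ`-space `V`
by `W` with power map `π` and commutator map `κ`. -/
theorem exists_endomorphism_lift {p : ℕ} [Fact p.Prime] {G V W : Type*} [Group G]
    [AddCommGroup V] [Module (ZMod p) V] [AddCommGroup W]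
    (q : G →* Multiplicative V) (hq : Function.Surjective q)
    (ι : Multiplicative W →* G) (hι : Function.Injective ι) (hker : q.ker = ι.range)
    (π : V → W) (hπ : ∀ g, ι (ofAdd (π (q g).toAdd)) = g ^ p)
    (κ : V → V → W) (hκ : ∀ g h, ι (ofAdd (κ (q g).toAdd (q h).toAdd)) = ⁅g, h⁆)
    (φ : V →+ V) (ψ : W →+ W) (hφπ : ∀ v, ψ (π v) = π (φ v))
    (hφκ : ∀ v w, ψ (κ v w) = κ (φ v) (φ w)) :
    ∃ f : G →* G, ∀ g, (q (f g)).toAdd = φ (q g).toAdd := by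
  have hqι : ∀ w, q (ι w) = 1 := fun w => by
    rw [← MonoidHom.mem_ker, hker]
    exact ⟨w, rfl⟩
  let φ' := AddMonoidHom.toMultiplicative φ
  let ψ' := AddMonoidHom.toMultiplicative ψ
  -- `H` is the fibre product of pairs lying over `φ`, and `D` below is the graph of `ψ` on the
  -- kernel. Compatibility makes `H/D` elementary abelian, and a splitting of `H/D → V` pulls back
  -- to the graph of the lift.
  let H : Subgroup (G × G) :=
    MonoidHom.eqLocus ((φ'.comp q).comp (MonoidHom.fst G G)) (q.comp (MonoidHom.snd G G))
  have hH : ∀ x : G × G, x ∈ H ↔ φ' (q x.1) = q x.2 := fun _ => Iff.rfl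
  let D : Subgroup H := (MonoidHom.range (ι.prod (ι.comp ψ'))).comap H.subtype
  have hD : ∀ x : H, x ∈ D ↔ ∃ w, ι w = x.1.1 ∧ ι (ψ' w) = x.1.2 := fun x => by
    constructor
    · rintro ⟨w, hw⟩
      exact ⟨w, congrArg Prod.fst hw, congrArg Prod.snd hw⟩
    · rintro ⟨w, h1, h2⟩
      exact ⟨w, Prod.ext h1 h2⟩
  let T : H →* Multiplicative V := (q.comp (MonoidHom.fst G G)).comp H.subtype
  have hTs : Function.Surjective T := by
    intro v
    obtain ⟨g, rfl⟩ := hq v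
    obtain ⟨h, hh⟩ := hq (φ' (q g))
    exact ⟨⟨(g, h), hh.symm⟩, rfl⟩
  have hcomm : ∀ x y : H, ⁅x, y⁆ ∈ D := by
    rintro ⟨⟨g, h⟩, hgh⟩ ⟨⟨g', h'⟩, hgh'⟩
    have e1 : φ (q g).toAdd = (q h).toAdd := congrArg toAdd hgh
    have e2 : φ (q g').toAdd = (q h').toAdd := congrArg toAdd hgh'
    refine (hD _).mpr ⟨_, hκ g g', ?_⟩
    have := hκ h h'
    rw [← e1, ← e2, ← hφκ] at this
    exact this
  have hpow : ∀ x : H, x ^ p ∈ D := by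
    rintro ⟨⟨g, h⟩, hgh⟩
    have e1 : φ (q g).toAdd = (q h).toAdd := congrArg toAdd hgh
    refine (hD _).mpr ⟨_, hπ g, ?_⟩
    have := hπ h
    rw [← e1, ← hφπ] at this
    exact this
  have hDT : D ≤ T.ker := by
    intro x hx
    obtain ⟨w, hw, -⟩ := (hD x).mp hx
    change q x.1.1 = 1
    rw [← hw, hqι]
  obtain ⟨L, hL1, hDL, hL2⟩ := exists_subgroup_inf_ker_eq T hTs D hcomm hpow hDT
  let L' : Subgroup (G × G) := L.map H.subtype
  have hbij : Function.Bijective (Prod.fst ∘ L'.subtype) := by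
    constructor
    · have : Function.Injective ((MonoidHom.fst G G).comp L'.subtype) := by
        rw [injective_iff_map_eq_one]
        rintro ⟨_, x, hx, rfl⟩ h1
        have h1 : x.1.1 = 1 := h1
        obtain ⟨w, hw1, hw2⟩ := (hD x).mp (hL1 x hx (by simp [T, h1]))
        have : w = 1 := hι (by rw [hw1, h1, map_one])
        rw [this, map_one, map_one] at hw2
        ext
        · exact h1
        · exact hw2.symm
      exact this
    · intro g
      obtain ⟨x, hxL, hx⟩ := hL2 (q g)
      have hx : q x.1.1 = q g := hx
      obtain ⟨w, hw⟩ : g * x.1.1⁻¹ ∈ ι.range := by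
        rw [← hker, MonoidHom.mem_ker, map_mul, map_inv, hx, mul_inv_cancel]
      have hdH : (ι w, ι (ψ' w)) ∈ H := by simp [hH, hqι]
      have hd : (⟨_, hdH⟩ : H) ∈ D := (hD _).mpr ⟨w, rfl, rfl⟩
      refine ⟨⟨_, ⟨⟨_, hdH⟩ * x, mul_mem (hDL hd) hxL, rfl⟩⟩, ?_⟩
      simp [hw]
  obtain ⟨f, hf⟩ := Subgroup.exists_eq_graph hbij
  refine ⟨f, fun g => ?_⟩
  have : (g, f g) ∈ L' := by
    rw [hf, MonoidHom.mem_graph]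
  obtain ⟨x, -, hx⟩ := this
  have hxH := x.2
  rw [show (x : G × G) = (g, f g) from hx, hH] at hxH
  exact congrArg toAdd hxH.symm

/-! ### From the group to its commutator and power maps -/

theorem IsNGenerator.exists_closure_range_eq_top {n : ℕ} {G : Type*} [Group G]
    (h : IsNGenerator n G) : ∃ g : Fin n → G, Subgroup.closure (Set.range g) = ⊤ := by
  obtain ⟨S, hS, htop⟩ := h
  -- A set with fewer than `n` elements is padded with `1`.
  refine ⟨fun i => S.toList.getD i 1, eq_top_iff.mpr ?_⟩
  rw [← htop]
  refine Subgroup.closure_mono fun x hx => ?_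
  obtain ⟨i, hi, rfl⟩ := List.getElem_of_mem (Finset.mem_toList.mpr hx)
  rw [Finset.length_toList] at hi
  exact ⟨⟨i, hi.trans_le hS⟩, by simp [hi]⟩

theorem commutatorElement_mul_left_of_mem_center {G : Type*} [Group G] {a b c : G}
    (h : ⁅b, c⁆ ∈ Subgroup.center G) : ⁅a * b, c⁆ = ⁅a, c⁆ * ⁅b, c⁆ := by
  have h1 : ⁅a * b, c⁆ = a * ⁅b, c⁆ * (c * a⁻¹ * c⁻¹) := by
    simp [commutatorElement_def, mul_assoc]
  rw [h1, mul_assoc, ← Subgroup.mem_center_iff.mp h, ← mul_assoc]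
  simp [commutatorElement_def, mul_assoc]

/-- For odd `p`, the exponent `p * (p - 1) / 2` of the commutator is a multiple of `p`. -/
theorem mul_pow_of_commutatorElement_pow_eq_one {p : ℕ} (hp : Odd p) {G : Type*} [Group G]
    {x y : G} (hc : ⁅y, x⁆ ∈ Subgroup.center G) (h : ⁅y, x⁆ ^ p = 1) :
    (x * y) ^ p = x ^ p * y ^ p := by
  rw [mul_pow_mul_commutatorElement_pow x y hc, Nat.mul_div_assoc _ (Nat.Odd.sub_odd hp odd_one).two_dvd,
    pow_mul, h, one_pow, mul_one]

open Multiplicative in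
/-- A 3-generator E-group which is a central extension of `𝔽ₚ`-spaces and whose elements of order
`p` are central is abelian. -/
theorem IsEGroup.commutatorElement_eq_one_of_extension {p : ℕ} [Fact p.Prime] (hp : Odd p)
    {G V W : Type*} [Group G] [AddCommGroup V] [Module (ZMod p) V] [AddCommGroup W]
    [Module (ZMod p) W] (hE : IsEGroup G) (hgen : IsNGenerator 3 G)
    (hΩ : ∀ u : G, u ^ p = 1 → u ∈ Subgroup.center G)
    (q : G →* Multiplicative V) (hq : Function.Surjective q)
    (ι : Multiplicative W →* G) (hι : Function.Injective ι) (hker : q.ker = ι.range)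
    (hcom : commutator G = ι.range) (g h : G) : ⁅g, h⁆ = 1 := by
  have hιp : ∀ w, ι w ^ p = 1 := fun w => by
    rw [← map_pow, ← map_one ι]
    congr 1
    have : p • w.toAdd = 0 := ZModModule.char_nsmul_eq_zero p _
    exact congrArg ofAdd this
  have hιc : ∀ w, ι w ∈ Subgroup.center G := fun w => hΩ _ (hιp w)
  have hrange : ∀ {a b}, q a = q b → ∃ w, a = b * ι w := fun {a b} hab => by
    have : b⁻¹ * a ∈ q.ker := by simp [MonoidHom.mem_ker, hab]
    rw [hker] at this
    obtain ⟨w, hw⟩ := this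
    exact ⟨w, by rw [hw, mul_inv_cancel_left]⟩
  have hcomι : ∀ a b : G, ∃ w : W, ι (ofAdd w) = ⁅a, b⁆ := fun a b => by
    have : ⁅a, b⁆ ∈ ι.range := by
      rw [← hcom, commutator_def]
      exact Subgroup.commutator_mem_commutator (Subgroup.mem_top a) (Subgroup.mem_top b)
    exact this
  have hcc : ∀ a b : G, ⁅a, b⁆ ∈ Subgroup.center G := fun a b => by
    obtain ⟨w, hw⟩ := hcomι a b
    exact hw ▸ hιc _
  have hcp : ∀ a b : G, ⁅a, b⁆ ^ p = 1 := fun a b => by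
    obtain ⟨w, hw⟩ := hcomι a b
    exact hw ▸ hιp _
  have hpι : ∀ a : G, ∃ w : W, ι (ofAdd w) = a ^ p := fun a => by
    have : a ^ p ∈ q.ker := by
      have : p • (q a).toAdd = 0 := ZModModule.char_nsmul_eq_zero p _
      rw [MonoidHom.mem_ker, map_pow]
      exact congrArg ofAdd this
    rw [hker] at this
    exact this
  have hleft : ∀ a b c : G, ⁅a * b, c⁆ = ⁅a, c⁆ * ⁅b, c⁆ := fun a b c =>
    commutatorElement_mul_left_of_mem_center (hcc b c)
  have hright : ∀ a b c : G, ⁅a, b * c⁆ = ⁅a, b⁆ * ⁅a, c⁆ := fun a b c => by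
    rw [← commutatorElement_inv, hleft, mul_inv_rev, commutatorElement_inv, commutatorElement_inv,
      Subgroup.mem_center_iff.mp (hcc a b)]
  have hmulp : ∀ a b : G, (a * b) ^ p = a ^ p * b ^ p := fun a b =>
    mul_pow_of_commutatorElement_pow_eq_one hp (hcc b a) (hcp b a)
  have hq' : ∀ v : V, ∃ a, (q a).toAdd = v := fun v => hq (ofAdd v)
  -- The maps on `V` are defined through a section `r`; centrality and exponent `p` of the kernel
  -- make the choice irrelevant.
  choose r hr using hq'
  choose com hcomm using hcomι
  choose pw hpw using hpι
  have hκ : ∀ a b, ι (ofAdd (com (r (q a).toAdd) (r (q b).toAdd))) = ⁅a, b⁆ := fun a b => by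
    obtain ⟨w, hw⟩ := hrange (toAdd.injective (hr (q a).toAdd))
    obtain ⟨w', hw'⟩ := hrange (toAdd.injective (hr (q b).toAdd))
    have h1 : ∀ c : G, ⁅ι w, c⁆ = 1 := fun c => by
      rw [commutatorElement_eq_one_iff_mul_comm, Subgroup.mem_center_iff.mp (hιc w)]
    have h2 : ∀ c, ⁅c, ι w'⁆ = 1 := fun c => by
      rw [commutatorElement_eq_one_iff_mul_comm, Subgroup.mem_center_iff.mp (hιc w')]
    rw [hcomm, hw, hw', hleft, hright, h1, h2, mul_one, mul_one]
  have hπ : ∀ a, ι (ofAdd (pw (r (q a).toAdd))) = a ^ p := fun a => by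
    obtain ⟨w, hw⟩ := hrange (toAdd.injective (hr (q a).toAdd))
    rw [hpw, hw, hmulp, hιp, mul_one]
  have hinj : ∀ {w w' : W}, ι (ofAdd w) = ι (ofAdd w') → w = w' := fun hw =>
    ofAdd.injective (hι hw)
  have hsurj : ∀ v : V, ∃ a, v = (q a).toAdd := fun v => ⟨r v, (hr v).symm⟩
  have hadd₁ : ∀ u v w, com (r (u + v)) (r w) = com (r u) (r w) + com (r v) (r w) := by
    intro u v w
    obtain ⟨a, rfl⟩ := hsurj u
    obtain ⟨b, rfl⟩ := hsurj v
    obtain ⟨c, rfl⟩ := hsurj w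
    apply hinj
    rw [ofAdd_add, map_mul, ← toAdd_mul, ← map_mul, hκ, hκ, hκ, hleft]
  have hadd₂ : ∀ u v w, com (r u) (r (v + w)) = com (r u) (r v) + com (r u) (r w) := by
    intro u v w
    obtain ⟨a, rfl⟩ := hsurj u
    obtain ⟨b, rfl⟩ := hsurj v
    obtain ⟨c, rfl⟩ := hsurj w
    apply hinj
    rw [ofAdd_add, map_mul, ← toAdd_mul, ← map_mul, hκ, hκ, hκ, hright]
  have hπadd : ∀ u v, pw (r (u + v)) = pw (r u) + pw (r v) := by
    intro u v
    obtain ⟨a, rfl⟩ := hsurj u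
    obtain ⟨b, rfl⟩ := hsurj v
    apply hinj
    rw [ofAdd_add, map_mul, ← toAdd_mul, ← map_mul, hπ, hπ, hπ, hmulp]
  let κ : V →ₗ[ZMod p] V →ₗ[ZMod p] W := LinearMap.mk₂ (ZMod p) (fun v w => com (r v) (r w))
    hadd₁ (fun c v w => ZMod.map_smul (AddMonoidHom.mk' (fun v => com (r v) (r w))
      (hadd₁ · · w)) c v) hadd₂
    (fun c v w => ZMod.map_smul (AddMonoidHom.mk' (fun w => com (r v) (r w)) (hadd₂ v)) c w)
  let π : V →ₗ[ZMod p] W := AddMonoidHom.toZModLinearMap p (AddMonoidHom.mk' (fun v => pw (r v)) hπadd)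
  replace hκ : ∀ a b, ι (ofAdd (κ (q a).toAdd (q b).toAdd)) = ⁅a, b⁆ := hκ
  replace hπ : ∀ a, ι (ofAdd (π (q a).toAdd)) = a ^ p := hπ
  have hzero : ∀ {w : W}, ι (ofAdd w) = 1 → w = 0 := fun hw =>
    hinj (by rw [hw, ofAdd_zero, map_one])
  obtain ⟨x, hx⟩ := hgen.exists_closure_range_eq_top
  let s := Fintype.linearCombination (ZMod p) (fun i => (q (x i)).toAdd)
  have hs : Function.Surjective s := fun v => by
    obtain ⟨a, rfl⟩ := hsurj v
    have hle : Subgroup.closure (Set.range x) ≤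
        (AddSubgroup.toSubgroup (LinearMap.range s).toAddSubgroup).comap q := by
      rw [Subgroup.closure_le]
      rintro _ ⟨i, rfl⟩
      exact ⟨Pi.single i 1, by simp [s]⟩
    rw [hx] at hle
    exact hle (Subgroup.mem_top a)
  have hspan : Submodule.span (ZMod p) {x | ∃ v w, κ v w = x} = ⊤ := by
    set S := Submodule.span (ZMod p) {x | ∃ v w, κ v w = x}
    have hle : commutator G ≤ (AddSubgroup.toSubgroup S.toAddSubgroup).map ι := by
      rw [commutator_def, Subgroup.commutator_le]
      intro a _ b _
      have hS : κ (q a).toAdd (q b).toAdd ∈ S := Submodule.subset_span ⟨_, _, rfl⟩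
      exact ⟨ofAdd (κ (q a).toAdd (q b).toAdd), hS, hκ a b⟩
    rw [eq_top_iff]
    intro w _
    rw [hcom] at hle
    obtain ⟨w', hw', hww⟩ := hle ⟨ofAdd w, rfl⟩
    have := hι hww
    subst this
    exact hw'
  have h2 : (2 : ZMod p) ≠ 0 := fun h => by
    have hd : p ∣ 2 := (ZMod.natCast_eq_zero_iff 2 p).mp (by exact_mod_cast h)
    rw [(Nat.prime_dvd_prime_iff_eq Fact.out Nat.prime_two).mp hd] at hp
    exact absurd hp (by decide)
  have hκ0 : κ = 0 := by
    refine alternating_eq_zero_of_endomorphisms h2 κ (fun v => ?_) hspan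
      π (fun v hv => ?_) s hs fun φ ψ h1 h2 v => ?_
    · obtain ⟨a, rfl⟩ := hsurj v
      exact hzero (by rw [hκ, commutatorElement_self])
    · obtain ⟨a, rfl⟩ := hsurj v
      have ha := hΩ a (by rw [← hπ, hv, ofAdd_zero, map_one])
      ext w
      obtain ⟨b, rfl⟩ := hsurj w
      refine hzero ?_
      rw [hκ, commutatorElement_eq_one_iff_mul_comm, Subgroup.mem_center_iff.mp ha]
    · obtain ⟨f, hf⟩ := exists_endomorphism_lift q hq ι hι hker π hπ (fun v w => κ v w) hκ
        φ.toAddMonoidHom ψ.toAddMonoidHom h1 h2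
      obtain ⟨a, rfl⟩ := hsurj v
      have hf := hf a
      refine hzero ?_
      rw [LinearMap.toAddMonoidHom_coe] at hf
      rw [← hf, hκ, commutatorElement_eq_one_iff_commute]
      exact hE f a
  rw [← hκ, hκ0]
  simp

/-- A 3-generator E-group in which elements of order `p` are central and `p`-th powers are products
of commutators is abelian. -/
theorem IsEGroup.commutatorElement_eq_one {p : ℕ} [Fact p.Prime] (hp : Odd p)
    {G : Type*} [Group G] (hE : IsEGroup G) (hgen : IsNGenerator 3 G)
    (hΩ : ∀ u : G, u ^ p = 1 → u ∈ Subgroup.center G)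
    (hpow : ∀ u : G, u ^ p ∈ commutator G) (hcp : ∀ u ∈ commutator G, u ^ p = 1)
    (g h : G) : ⁅g, h⁆ = 1 := by
  obtain ⟨W, _, ι, hι, hcom⟩ : ∃ (W : Type _) (_ : AddCommGroup W) (ι : Multiplicative W →* G),
      Function.Injective ι ∧ commutator G = ι.range := by
    let : CommGroup (commutator G) :=
      { (inferInstance : Group (commutator G)) with
        mul_comm := fun a b =>
          Subtype.ext (Subgroup.mem_center_iff.mp (hΩ b (hcp b b.2)) a) }
    exact ⟨Additive (commutator G), inferInstance, (commutator G).subtype,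
      (commutator G).subtype_injective, (commutator G).range_subtype.symm⟩
  obtain ⟨V, _, q, hq, hker⟩ : ∃ (V : Type _) (_ : AddCommGroup V) (q : G →* Multiplicative V),
      Function.Surjective q ∧ q.ker = commutator G :=
    ⟨Additive (Abelianization G), inferInstance, Abelianization.of,
      QuotientGroup.mk_surjective, Abelianization.ker_of G⟩
  let : Module (ZMod p) W := AddCommGroup.zmodModule fun w => by
    have : ι (Multiplicative.ofAdd w) ^ p = 1 := hcp _ (hcom ▸ ⟨_, rfl⟩)
    rw [← map_pow, ← map_one ι] at this
    exact congrArg Multiplicative.toAdd (hι this)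
  let : Module (ZMod p) V := AddCommGroup.zmodModule fun v => by
    obtain ⟨a, ha⟩ := hq (Multiplicative.ofAdd v)
    have := hpow a
    rw [← hker, MonoidHom.mem_ker, map_pow, ha] at this
    exact congrArg Multiplicative.toAdd this
  exact hE.commutatorElement_eq_one_of_extension hp hgen hΩ q hq ι hι (hker.trans hcom) hcom g h

/-! ### Reduction to central elements of order `p` -/

theorem corollary2p13 (p : ℕ) (hp : p.Prime) (hp2 : 2 < p)
    (G : Type*) [Group G] [Finite G]
    (hE : IsPEGroup p G) (hgen : IsNGenerator 3 G)
    (hexp : Monoid.exponent G ≤ p ^ 2) :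
    ∀ a b : G, a * b = b * a := by
  have : Fact p.Prime := ⟨hp⟩
  obtain ⟨hP, hE⟩ := hE
  intro a b
  rw [← commutatorElement_eq_one_iff_mul_comm]
  by_contra hab
  have : Nontrivial G := ⟨_, _, hab⟩
  have hexp2 : Monoid.exponent G ∣ p ^ 2 := by
    obtain ⟨n, hn⟩ := IsPGroup.iff_card.mp hP
    obtain ⟨k, -, hk⟩ := (Nat.dvd_prime_pow hp).mp (hn ▸ Group.exponent_dvd_nat_card (G := G))
    rw [hk] at hexp ⊢
    exact pow_dvd_pow p ((Nat.pow_le_pow_iff_right hp.one_lt).mp hexp)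
  have hab2 : Monoid.exponent (Abelianization G) ∣ p ^ 2 :=
    (Group.exponent_quotient_dvd (commutator G)).trans hexp2
  have hne : Monoid.exponent (Abelianization G) ≠ 1 := fun h1 => by
    have := hP.isNilpotent
    -- A nontrivial finite `p`-group is nilpotent, so its abelianization is nontrivial.
    have hlt : commutator G < ⊤ := Group.IsSolvable.commutator_lt_top_of_nontrivial G
    rw [Monoid.exp_eq_one_iff] at h1
    refine hlt.ne ((Subgroup.eq_top_iff' _).mpr fun x => ?_)
    rw [← Abelianization.ker_of, MonoidHom.mem_ker]
    exact Subsingleton.elim _ _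
  have hdvd : p ∣ Monoid.exponent (Abelianization G) := by
    obtain ⟨k, -, hk⟩ := (Nat.dvd_prime_pow hp).mp hab2
    rw [hk] at hne ⊢
    exact dvd_pow_self p fun h => hne (by rw [h, pow_zero])
  have hΩ : ∀ u : G, u ^ p = 1 → u ∈ Subgroup.center G := fun u hu => by
    apply hE.mem_center_of_pow_exponent_abelianization
    obtain ⟨c, hc⟩ := hdvd
    rw [hc, pow_mul, hu, one_pow]
  have hpp : ∀ u : G, (u ^ p) ^ p = 1 := fun u => by
    rw [← pow_mul, ← sq]
    exact Monoid.exponent_dvd_iff_forall_pow_eq_one.mp hexp2 u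
  have hpow : ∀ u : G, u ^ p ∈ commutator G := by
    have hp1 : Monoid.exponent (Abelianization G) ∣ p := by
      obtain ⟨k, hk2, hk⟩ := (Nat.dvd_prime_pow hp).mp hab2
      rw [hk]
      by_contra hnd
      have hk2 : k = 2 := by
        by_contra hk2
        exact hnd ((pow_dvd_pow p (show k ≤ 1 by omega)).trans (pow_one p).dvd)
      apply hab
      rw [commutatorElement_eq_one_iff_mul_comm]
      -- If `G/G'` had exponent `p ^ 2`, every element of `G` would be central.
      refine Subgroup.mem_center_iff.mp (hE.mem_center_of_pow_exponent_abelianization ?_) a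
      rw [hk, hk2, sq, pow_mul, hpp]
    intro u
    rw [← Abelianization.ker_of, MonoidHom.mem_ker, map_pow]
    exact Monoid.exponent_dvd_iff_forall_pow_eq_one.mp hp1 _
  have hcomp : ∀ x y : G, ⁅x, y⁆ ^ p = 1 := fun x y => by
    rw [← hE.commutatorElement_pow_left, commutatorElement_eq_one_iff_mul_comm,
      Subgroup.mem_center_iff.mp (hΩ _ (hpp x))]
  refine hab (hE.commutatorElement_eq_one (hp.odd_of_ne_two hp2.ne') hgen hΩ hpow ?_ a b)
  intro u hu
  rw [commutator_eq_closure] at hu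
  induction hu using Subgroup.closure_induction with
  | mem _ h =>
    obtain ⟨x, y, rfl⟩ := h
    exact hcomp x y
  | one => exact one_pow p
  | mul x y _ _ hx hy =>
    have h : Commute x y := Subgroup.mem_center_iff.mp (hΩ y hy) x
    rw [h.mul_pow, hx, hy, one_mul]
  | inv x _ hx => rw [inv_pow, hx, inv_one]
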